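/- Let $\mathbb X,\mathbb U,\mathbb K$ be real Hilbert spaces with $\mathbb X$ separable. Let $\mathcal A:D(\mathcal A)\subset\mathbb X\to\mathbb X$ generate a strongly continuous semigroup $\mathcal T(t)$ on $\mathbb X$. Let $\mathcal F:\mathbb X\to\mathbb X$ satisfy $\mathcal F(0)=0$ and be Lipschitz continuous on every ball $\{\|x\|\le\delta\}$; let $\mathcal F$ be Gâteaux differentiable on $\mathbb X$ with derivative $\mathcal F'_x\in\mathcal L(\mathbb X)$, and let $x\mapsto\mathcal F'_x$ map bounded sets to bounded sets. Let $K_{ad}\subset\mathbb K$, and for $r\in K_{ad}$ let $\mathcal B(r)\in\mathcal L(\mathbb U,\mathbb X)$ with $\sup_{r\in K_{ad}}\|\mathcal B(r)\|<\infty$; let $\mathcal B(\cdot):K_{ad}\to\mathcal L(\mathbb U,\mathbb X)$ be Gâteaux differentiable on $K_{ad}$ (at $r\in K_{ad}$, difference quotients are taken along points of $K_{ad}$) with derivative $\mathcal B'_r\in\mathcal L(\mathbb K,\mathcal L(\mathbb U,\mathbb X))$, and let $r\mapsto\mathcal B'_r$ map bounded subsets of $K_{ad}$ to bounded sets. Let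 $x_0\in\mathbb X$, $R>0$, and $U_{ad}=\{u\in L^2(0,\tau;\mathbb U):\|u\|_{L^2}\le R\}$, where $\tau>0$ is such that for all $u\in U_{ad}$ and $r\in K_{ad}$ the problem $\dot x=\mathcal Ax+\mathcal F(x)+\mathcal B(r)u$, $x(0)=x_0$, has a mild solution on $[0,\tau]$, i.e. a function $x\in C([0,\tau];\mathbb X)$ with $$x(t)=\mathcal T(t)x_0+\int_0^t\mathcal T(t-s)\mathcal F(x(s))\,ds+\int_0^t\mathcal T(t-s)\mathcal B(r)u(s)\,ds,\qquad t\in[0,\tau].$$ Let $\mathcal S(u;r,x_0)\in L^2(0,\tau;\mathbb X)$ denote this mild solution (control-to-state map). Then for every $u\in U_{ad}$ the map $r\mapsto\mathcal S(u;r,x_0)\in L^2(0,\tau;\mathbb X)$ is Gâteaux differentiable at every point $r^o$ of the interior of $K_{ad}$: there is a bounded linear operator $\mathcal S'_{r^o}:\mathbb K\to L^2(0,\tau;\mathbb X)$ with $$\lim_{\epsilon\to0}\Big\|\tfrac1\epsilon\big(\mathcal S(u;r^o+\epsilon\tilde r,x_0)-\mathcal S(u;r^o,x_0)\big)-\mathcal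 S'_{r^o}\tilde r\Big\|_{L^2(0,\tau;\mathbb X)}=0\qquad\text{for all }\tilde r\in\mathbb K.$$ Moreover, with $x^o=\mathcal S(u;r^o,x_0)$ (its continuous representative), for every $\tilde r\in\mathbb K$ one has $\mathcal S'_{r^o}\tilde r=\tilde y$, where $\tilde y\in C([0,\tau];\mathbb X)$ is the unique mild solution of $$\dot{\tilde y}(t)=(\mathcal A+\mathcal F'_{x^o(t)})\tilde y(t)+(\mathcal B'_{r^o}\tilde r)u(t),\qquad \tilde y(0)=0,$$ that is, the unique $\tilde y\in C([0,\tau];\mathbb X)$ with $\tilde y(t)=\int_0^t\mathcal T(t-s)\mathcal F'_{x^o(s)}\tilde y(s)\,ds+\int_0^t\mathcal T(t-s)(\mathcal B'_{r^o}\tilde r)u(s)\,ds$ for $t\in[0,\tau]$. -/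

import Mathlib

open MeasureTheory Filter Topology

noncomputable section

namespace SemilinearControl

/-- A strongly continuous semigroup `(T(t))_{t ≥ 0}` of bounded linear operators on `X`.
Only the values `T t` with `0 ≤ t` carry meaning. -/
structure C0Semigroup (X : Type*) [NormedAddCommGroup X] [NormedSpace ℝ X] where
  toFun : ℝ → X →L[ℝ] X
  map_zero : toFun 0 = ContinuousLinearMap.id ℝ X
  map_add : ∀ s t : ℝ, 0 ≤ s → 0 ≤ t → toFun (s + t) = (toFun s).comp (toFun t)
  continuousOn_orbit : ∀ x : X, ContinuousOn (fun t => toFun t x) (Set.Ici 0)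

instance {X : Type*} [NormedAddCommGroup X] [NormedSpace ℝ X] :
    CoeFun (C0Semigroup X) (fun _ => ℝ → X →L[ℝ] X) := ⟨C0Semigroup.toFun⟩

/-- The (possibly unbounded) operator `A : D(A) ⊆ X → X` generates the semigroup `T`:
`x ∈ D(A)` and `A x = y` if and only if `(T(h) x - x) / h → y` as `h ↓ 0`. -/
def Generates {X : Type*} [NormedAddCommGroup X] [NormedSpace ℝ X]
    (A : X →ₗ.[ℝ] X) (T : C0Semigroup X) : Prop :=
  ∀ x y : X, (x, y) ∈ A.graph ↔
    Tendsto (fun h : ℝ => h⁻¹ • (T h x - x)) (𝓝[>] 0) (𝓝 y)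

/-- `f` is Gateaux differentiable at `x` with derivative the bounded linear operator `f'`. -/
def HasGateauxDerivAt {E G : Type*} [NormedAddCommGroup E] [NormedSpace ℝ E]
    [NormedAddCommGroup G] [NormedSpace ℝ G] (f : E → G) (f' : E →L[ℝ] G) (x : E) : Prop :=
  ∀ h : E, HasLineDerivAt ℝ f (f' h) x h

/-- `f`, regarded as a map on the set `s` only, is Gateaux differentiable at `x` with derivative
the bounded linear operator `f'`: difference quotients are taken along points of `s`. -/
def HasGateauxDerivWithinAt {E G : Type*} [NormedAddCommGroup E] [NormedSpace ℝ E]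
    [NormedAddCommGroup G] [NormedSpace ℝ G] (f : E → G) (f' : E →L[ℝ] G) (s : Set E) (x : E) :
    Prop :=
  ∀ h : E, HasLineDerivWithinAt ℝ f (f' h) s x h

/-- The space `L²(0,τ;E)`. -/
abbrev L2 (τ : ℝ) (E : Type*) [NormedAddCommGroup E] :=
  Lp E 2 (volume.restrict (Set.Icc 0 τ))

/-- The admissible inputs: the closed ball of radius `R` in `L²(0,τ;U)`. -/
def Uad (τ R : ℝ) (U : Type*) [NormedAddCommGroup U] : Set (L2 τ U) :=
  {u | ‖u‖ ≤ R}

/-- `x ∈ C([0,τ];X)` is a mild solution of `x'(t) = A x(t) + f(t, x(t)) + g(t)`, `x(0) = x₀`,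
where `A` generates `T`:
`x(t) = T(t) x₀ + ∫₀ᵗ T(t-s) f(s, x(s)) ds + ∫₀ᵗ T(t-s) g(s) ds` for all `t ∈ [0,τ]`.
Only the restriction of `x` to `[0,τ]` matters. -/
def IsMildSolution {X : Type*} [NormedAddCommGroup X] [NormedSpace ℝ X]
    (T : C0Semigroup X) (τ : ℝ) (x₀ : X) (f : ℝ → X → X) (g : ℝ → X) (x : ℝ → X) : Prop :=
  ContinuousOn x (Set.Icc 0 τ) ∧
    ∀ t ∈ Set.Icc (0 : ℝ) τ,
      IntervalIntegrable (fun s => T (t - s) (f s (x s))) volume 0 t ∧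
      IntervalIntegrable (fun s => T (t - s) (g s)) volume 0 t ∧
      x t = T t x₀ + (∫ s in (0 : ℝ)..t, T (t - s) (f s (x s)))
        + ∫ s in (0 : ℝ)..t, T (t - s) (g s)

section State

variable {X U : Type*} [NormedAddCommGroup X] [NormedSpace ℝ X]
  [NormedAddCommGroup U] [NormedSpace ℝ U]

/-- `x` is a mild solution of the semilinear controlled system
`x'(t) = A x(t) + F(x(t)) + b u(t)`, `x(0) = x₀`, with input operator `b`. -/
def IsMildState (T : C0Semigroup X) (F : X → X) (τ : ℝ) (x₀ : X) (b : U →L[ℝ] X)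
    (u : L2 τ U) (x : ℝ → X) : Prop :=
  IsMildSolution T τ x₀ (fun _ z => F z) (fun s => b (u s)) x

open Classical in
/-- The mild solution of the semilinear controlled system, as a function of time
(zero if there is no mild solution). -/
def stateTrajectory (T : C0Semigroup X) (F : X → X) (τ : ℝ) (x₀ : X) (b : U →L[ℝ] X)
    (u : L2 τ U) : ℝ → X :=
  if h : ∃ x, IsMildState T F τ x₀ b u x then h.choose else 0

theorem isMildState_stateTrajectory (T : C0Semigroup X) (F : X → X) (τ : ℝ) (x₀ : X)
    (b : U →L[ℝ] X) (u : L2 τ U) (h : ∃ x, IsMildState T F τ x₀ b u x) :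
    IsMildState T F τ x₀ b u (stateTrajectory T F τ x₀ b u) := by
  unfold stateTrajectory
  rw [dif_pos h]
  exact h.choose_spec

theorem memLp_stateTrajectory (T : C0Semigroup X) (F : X → X) (τ : ℝ) (x₀ : X)
    (b : U →L[ℝ] X) (u : L2 τ U) :
    MemLp (stateTrajectory T F τ x₀ b u) 2 (volume.restrict (Set.Icc 0 τ)) := by
  by_cases h : ∃ x, IsMildState T F τ x₀ b u x
  · have hc : ContinuousOn (stateTrajectory T F τ x₀ b u) (Set.Icc 0 τ) :=
      (isMildState_stateTrajectory T F τ x₀ b u h).1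
    obtain ⟨C, hC⟩ := isCompact_Icc.exists_bound_of_continuousOn hc
    exact MemLp.of_bound (hc.aestronglyMeasurable_of_isCompact isCompact_Icc measurableSet_Icc) C
      ((ae_restrict_iff' measurableSet_Icc).2 (Eventually.of_forall hC))
  · unfold stateTrajectory
    rw [dif_neg h]
    exact MemLp.zero

/-- The control-to-state map `S(u; r, x₀) ∈ L²(0,τ;X)` for the family `B(·)` of input operators:
the class in `L²(0,τ;X)` of the mild solution of
`x'(t) = A x(t) + F(x(t)) + B(r) u(t)`, `x(0) = x₀`. -/
def controlToState {K : Type*} (T : C0Semigroup X) (F : X → X) (B : K → U →L[ℝ] X) (τ : ℝ)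
    (u : L2 τ U) (r : K) (x₀ : X) : L2 τ X :=
  (memLp_stateTrajectory T F τ x₀ (B r) u).toLp (stateTrajectory T F τ x₀ (B r) u)

end State

end SemilinearControl

end

open SemilinearControl

/-! Fix a control and a direction `r'`. Let `x` be the state for `r₀`, `x_ε` the state for `r₀ + ε
r'`, and `y` the solution of the linearized equation. Since `F` is only Gateaux differentiable, its
derivative cannot be applied to the increment `x_ε - x`, whose direction varies with `ε`. Instead
`x_ε` is compared with `x + ε y`: `F(x_ε) - F(x) = [F(x_ε) - F(x + ε y)] + [F(x + ε y) - F(x)]`.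
With `d = (x_ε - x)/ε - y`, the first bracket divided by `ε` is at most `L ‖d‖` by the Lipschitz
condition and is absorbed by Gronwall. The second has the fixed direction `y(s)` at each time, so
its quotient tends pointwise to `F'(x(s)) y(s)`, and dominated convergence makes the error vanish in
`L¹` (`tendsto_integral_norm_quotient_sub`). Together with the differentiability of `B`, this gives
`d → 0` uniformly on `[0,τ]` (`IsMildState.norm_quotient_sub_le`), hence in `L²`.

The Lipschitz condition is local, so `x_ε` must first be confined to a ball; this is a
first-exit-time argument (`IsMildState.norm_sub_le_one`). These estimates hold for any choice of
mild states, so uniqueness of the state is not needed separately.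

The linearized equation is solved by a contraction in an exponentially weighted norm
(`exists_linear_volterra`). A Gronwall bound gives uniqueness, and from it linearity and boundedness
of `r' ↦ y` (`exists_clm_linear_solution`). -/

namespace SemilinearControl

open Set

/-! ### Gronwall's inequality. -/

/-- Gronwall's inequality in integral form, for a continuous function on `[0,τ]`. -/
theorem le_mul_exp_of_le_add_integral {φ : ℝ → ℝ} {τ C K : ℝ} (hK : 0 ≤ K)
    (hφ : ContinuousOn φ (Icc 0 τ))
    (h : ∀ t ∈ Icc (0 : ℝ) τ, φ t ≤ C + K * ∫ s in (0 : ℝ)..t, φ s) :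
    ∀ t ∈ Icc (0 : ℝ) τ, φ t ≤ C * Real.exp (K * t) := by
  intro t ht
  have hτ : 0 ≤ τ := ht.1.trans ht.2
  -- Extending by constants makes the integral differentiable at every point, endpoints included.
  let ψ : ℝ → ℝ := IccExtend hτ ((Icc 0 τ).domRestrict φ)
  have hψ : Continuous ψ := (continuousOn_iff_continuous_domRestrict.1 hφ).Icc_extend'
  have hψφ : ∀ s ∈ Icc (0 : ℝ) τ, ψ s = φ s := fun s hs => IccExtend_of_mem hτ _ hs
  have hint : ∀ s ∈ Icc (0 : ℝ) τ, ∫ r in (0 : ℝ)..s, ψ r = ∫ r in (0 : ℝ)..s, φ r := by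
    intro s hs
    refine intervalIntegral.integral_congr fun r hr => hψφ r ?_
    rw [uIcc_of_le hs.1] at hr
    exact ⟨hr.1, hr.2.trans hs.2⟩
  have hderiv : ∀ s, HasDerivAt (fun s => C + K * ∫ r in (0 : ℝ)..s, ψ r) (K * ψ s) s := fun s =>
    ((hψ.integral_hasStrictDerivAt 0 s).hasDerivAt.const_mul K).const_add C
  -- The differential Gronwall lemma is applied to the majorant `C + K ∫ ψ`, since `φ` itself need
  -- not be differentiable.
  have key := le_gronwallBound_of_liminf_deriv_right_le (a := 0) (b := τ) (δ := C) (K := K) (ε := 0)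
    (f := fun s => C + K * ∫ r in (0 : ℝ)..s, ψ r) (f' := fun s => K * ψ s)
    (fun s _ => (hderiv s).continuousAt.continuousWithinAt)
    (fun s _ r hr => ((hderiv s).hasDerivWithinAt.liminf_right_slope_le hr))
    (by simp) (fun s hs => by
      have hs' := Ico_subset_Icc_self hs
      simpa [hψφ s hs', hint s hs'] using mul_le_mul_of_nonneg_left (h s hs') hK) t ht
  rw [gronwallBound_ε0, sub_zero] at key
  refine (h t ht).trans ?_
  simpa [hint t ht] using key

theorem intervalIntegrable_of_integrableOn_Icc {E : Type*} [NormedAddCommGroup E] {f : ℝ → E}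
    {τ t : ℝ} (hf : IntegrableOn f (Icc 0 τ)) (ht : t ∈ Icc 0 τ) :
    IntervalIntegrable f volume 0 t := by
  rw [intervalIntegrable_iff_integrableOn_Ioc_of_le ht.1]
  exact hf.mono_set fun s hs => ⟨hs.1.le, hs.2.trans ht.2⟩

/-! ### Convolution with a bounded strongly continuous kernel; linear Volterra equations. -/

section Convolution

variable {X : Type*} [NormedAddCommGroup X] [NormedSpace ℝ X] {k : ℝ → X →L[ℝ] X} {M τ : ℝ}

/-- The uniform bound upgrades strong continuity to joint continuity, which makes `s ↦ k (t - s) (f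
s)` measurable for any a.e. strongly measurable `f`. -/
theorem continuous_apply_of_bounded (hM : ∀ t, ‖k t‖ ≤ M) (hk : ∀ x, Continuous fun t => k t x) :
    Continuous fun p : ℝ × X => k p.1 p.2 := by
  rw [continuous_iff_continuousAt]
  rintro ⟨t, x⟩
  rw [ContinuousAt, tendsto_iff_norm_sub_tendsto_zero]
  have h1 : Tendsto (fun p : ℝ × X => M * ‖p.2 - x‖ + ‖k p.1 x - k t x‖) (𝓝 (t, x)) (𝓝 0) := by
    have : Continuous fun p : ℝ × X => M * ‖p.2 - x‖ + ‖k p.1 x - k t x‖ := by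
      have := (hk x).comp (continuous_fst (X := ℝ) (Y := X))
      simp only [Function.comp_def] at this
      fun_prop
    simpa using this.tendsto (t, x)
  refine squeeze_zero (fun _ => norm_nonneg _) (fun p => ?_) h1
  calc ‖k p.1 p.2 - k t x‖ = ‖k p.1 (p.2 - x) + (k p.1 x - k t x)‖ := by rw [map_sub]; abel_nf
    _ ≤ M * ‖p.2 - x‖ + ‖k p.1 x - k t x‖ :=
      (norm_add_le _ _).trans (by gcongr; exact (k p.1).le_of_opNorm_le (hM _) _)

theorem integrableOn_convolution (hM : ∀ t, ‖k t‖ ≤ M) (hk : ∀ x, Continuous fun t => k t x)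
    {f : ℝ → X} (hf : IntegrableOn f (Icc 0 τ)) (t : ℝ) :
    IntegrableOn (fun s => k (t - s) (f s)) (Icc 0 τ) := by
  refine (hf.norm.const_mul M).mono' ?_
    (Eventually.of_forall fun s => (k (t - s)).le_of_opNorm_le (hM _) _)
  exact (continuous_apply_of_bounded hM hk).comp_aestronglyMeasurable
    ((by fun_prop : Continuous fun s : ℝ => t - s).aestronglyMeasurable.prodMk
      hf.aestronglyMeasurable)

theorem intervalIntegrable_convolution (hM : ∀ t, ‖k t‖ ≤ M)
    (hk : ∀ x, Continuous fun t => k t x) {f : ℝ → X} (hf : IntegrableOn f (Icc 0 τ)) {t : ℝ}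
    (ht : t ∈ Icc 0 τ) : IntervalIntegrable (fun s => k (t - s) (f s)) volume 0 t :=
  intervalIntegrable_of_integrableOn_Icc (integrableOn_convolution hM hk hf t) ht

theorem norm_integral_convolution_le (hM : ∀ t, ‖k t‖ ≤ M) {f : ℝ → X}
    (hf : IntegrableOn f (Icc 0 τ)) {t : ℝ} (ht : t ∈ Icc 0 τ) :
    ‖∫ s in (0 : ℝ)..t, k (t - s) (f s)‖ ≤ M * ∫ s in (0 : ℝ)..t, ‖f s‖ := by
  rw [← intervalIntegral.integral_const_mul]
  exact intervalIntegral.norm_integral_le_of_norm_le ht.1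
    (Eventually.of_forall fun s _ => (k (t - s)).le_of_opNorm_le (hM _) _)
    ((intervalIntegrable_of_integrableOn_Icc hf ht).norm.const_mul M)

theorem integral_mono_horizon {f : ℝ → ℝ} (hf : IntegrableOn f (Icc 0 τ)) (h0 : ∀ s, 0 ≤ f s)
    {t : ℝ} (ht : t ∈ Icc 0 τ) : ∫ s in (0 : ℝ)..t, f s ≤ ∫ s in (0 : ℝ)..τ, f s :=
  intervalIntegral.integral_mono_interval le_rfl ht.1 ht.2 (Eventually.of_forall h0)
    (intervalIntegrable_of_integrableOn_Icc hf ⟨ht.1.trans ht.2, le_rfl⟩)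

theorem norm_integral_convolution_le' (hM : ∀ t, ‖k t‖ ≤ M) {f : ℝ → X}
    (hf : IntegrableOn f (Icc 0 τ)) {t : ℝ} (ht : t ∈ Icc 0 τ) :
    ‖∫ s in (0 : ℝ)..t, k (t - s) (f s)‖ ≤ M * ∫ s in (0 : ℝ)..τ, ‖f s‖ :=
  (norm_integral_convolution_le hM hf ht).trans <|
    mul_le_mul_of_nonneg_left (integral_mono_horizon hf.norm (fun _ => norm_nonneg _) ht)
      ((norm_nonneg _).trans (hM 0))

/-- An indicator turns the integral into one over the fixed interval `[0,τ]`. For each `s ≠ t` the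
integrand is then continuous at `t`, and `M ‖f s‖` dominates it. -/
theorem continuousOn_integral_convolution (hM : ∀ t, ‖k t‖ ≤ M)
    (hk : ∀ x, Continuous fun t => k t x) {f : ℝ → X} (hf : IntegrableOn f (Icc 0 τ)) :
    ContinuousOn (fun t => ∫ s in (0 : ℝ)..t, k (t - s) (f s)) (Icc 0 τ) := by
  have hM0 : 0 ≤ M := (norm_nonneg _).trans (hM 0)
  have hcont : Continuous fun t : ℝ =>
      ∫ s in Icc 0 τ, (Iio t).indicator (fun s => k (t - s) (f s)) s := by
    rw [continuous_iff_continuousAt]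
    intro t
    refine continuousAt_of_dominated (bound := fun s => M * ‖f s‖) ?_ ?_ (hf.norm.const_mul M) ?_
    · exact Eventually.of_forall fun r =>
        (integrableOn_convolution hM hk hf r).aestronglyMeasurable.indicator measurableSet_Iio
    · exact Eventually.of_forall fun r => Eventually.of_forall fun s =>
        (norm_indicator_le_norm_self _ _).trans ((k (r - s)).le_of_opNorm_le (hM _) _)
    · have hne : ∀ᵐ s ∂(volume.restrict (Icc 0 τ)), s ≠ t :=
        ae_restrict_of_ae (Measure.ae_ne volume t)
      filter_upwards [hne] with s hs
      rcases lt_or_gt_of_ne hs with h | h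
      · have : (fun r => k (r - s) (f s)) =ᶠ[𝓝 t]
            fun r => (Iio r).indicator (fun s => k (r - s) (f s)) s := by
          filter_upwards [lt_mem_nhds h] with r hr
          rw [indicator_of_mem (show s ∈ Iio r from hr)]
        refine ContinuousAt.congr ?_ this
        exact ((hk (f s)).comp (by fun_prop : Continuous fun r : ℝ => r - s)).continuousAt
      · have : (fun _ => (0 : X)) =ᶠ[𝓝 t]
            fun r => (Iio r).indicator (fun s => k (r - s) (f s)) s := by
          filter_upwards [gt_mem_nhds h] with r hr
          rw [indicator_of_notMem (show s ∉ Iio r from not_lt.2 hr.le)]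
        exact continuousAt_const.congr this
  refine hcont.continuousOn.congr fun t ht => ?_
  simp only
  rw [integral_indicator measurableSet_Iio, Measure.restrict_restrict measurableSet_Iio,
    intervalIntegral.integral_of_le ht.1, integral_Ioc_eq_integral_Ioo, ← integral_Ico_eq_integral_Ioo]
  congr 2
  ext s
  simp only [mem_Ico, mem_inter_iff, mem_Iio, mem_Icc]
  exact ⟨fun h => ⟨h.2, h.1, h.2.le.trans ht.2⟩, fun h => ⟨h.2.1, h.1⟩⟩

theorem integral_exp_mul_sub_le {c : ℝ} (hc : 0 < c) (t : ℝ) :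
    ∫ s in (0 : ℝ)..t, Real.exp (-(c * (t - s))) ≤ c⁻¹ := by
  have h : ∀ s ∈ uIcc (0 : ℝ) t, HasDerivAt (fun s => c⁻¹ * Real.exp (-(c * (t - s))))
      (Real.exp (-(c * (t - s)))) s := by
    intro s _
    have h1 : HasDerivAt (fun s : ℝ => -(c * (t - s))) c s := by
      convert! (((hasDerivAt_id s).const_sub t).const_mul c).neg using 1
      ring
    convert! h1.exp.const_mul c⁻¹ using 1
    field_simp
  rw [intervalIntegral.integral_eq_sub_of_hasDerivAt h
    (Continuous.intervalIntegrable (by fun_prop) _ _)]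
  have := mul_pos (inv_pos.2 hc) (Real.exp_pos (-(c * (t - 0))))
  simp only [sub_self, mul_zero, neg_zero, Real.exp_zero, mul_one] at *
  linarith

/-- Existence for linear Volterra equations with a strongly continuous kernel. -/
theorem exists_linear_volterra [CompleteSpace X] (hτ : 0 ≤ τ) (hM : ∀ t, ‖k t‖ ≤ M)
    (hk : ∀ x, Continuous fun t => k t x) {Φ : ℝ → X →L[ℝ] X} {L : ℝ}
    (hΦ : ∀ s ∈ Icc (0 : ℝ) τ, ‖Φ s‖ ≤ L)
    (hΦm : ∀ w : ℝ → X, ContinuousOn w (Icc 0 τ) → IntegrableOn (fun s => Φ s (w s)) (Icc 0 τ))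
    {h : ℝ → X} (hh : ContinuousOn h (Icc 0 τ)) :
    ∃ y : ℝ → X, ContinuousOn y (Icc 0 τ) ∧
      ∀ t ∈ Icc (0 : ℝ) τ, y t = (∫ s in (0 : ℝ)..t, k (t - s) (Φ s (y s))) + h t := by
  have hM0 : 0 ≤ M := (norm_nonneg _).trans (hM 0)
  have hL0 : 0 ≤ L := (norm_nonneg _).trans (hΦ 0 ⟨le_rfl, hτ⟩)
  -- The weight rate is chosen so that `M L / c ≤ 1/2`; the `+ 1` keeps it positive when `M L = 0`.
  set c : ℝ := 2 * (M * L) + 1 with hc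
  have hc0 : 0 < c := by positivity
  -- The weight is moved into the kernel: `w(t) = exp(-c t) y(t)` solves the equation with kernel
  -- `exp(-c t) k(t)`, so the plain sup norm suffices. The absolute value keeps the kernel bounded
  -- on all of `ℝ`.
  let kc : ℝ → X →L[ℝ] X := fun t => Real.exp (-(c * |t|)) • k t
  have hkcn : ∀ t, ‖kc t‖ ≤ Real.exp (-(c * |t|)) * M := fun t => by
    simp only [kc, norm_smul, Real.norm_eq_abs, Real.abs_exp]
    gcongr
    exact hM t
  have hkcM : ∀ t, ‖kc t‖ ≤ M := fun t => (hkcn t).trans <| by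
    refine mul_le_of_le_one_left hM0 (Real.exp_le_one_iff.2 ?_)
    have := mul_nonneg hc0.le (abs_nonneg t)
    linarith
  have hkc : ∀ x, Continuous fun t => kc t x := fun x => by
    have := hk x
    simp only [kc, smul_apply]
    fun_prop
  let ext : C(Icc (0 : ℝ) τ, X) → ℝ → X := fun w => IccExtend hτ w
  have hext : ∀ w, Continuous (ext w) := fun w => w.continuous.Icc_extend'
  have hextint : ∀ w, IntegrableOn (fun s => Φ s (ext w s)) (Icc 0 τ) := fun w =>
    hΦm _ (hext w).continuousOn
  let rhs : C(Icc (0 : ℝ) τ, X) → ℝ → X := fun w t =>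
    (∫ s in (0 : ℝ)..t, kc (t - s) (Φ s (ext w s))) + Real.exp (-(c * t)) • h t
  have hrhs : ∀ w, ContinuousOn (rhs w) (Icc 0 τ) := fun w =>
    (continuousOn_integral_convolution hkcM hkc (hextint w)).add
      ((by fun_prop : Continuous fun t : ℝ => Real.exp (-(c * t))).continuousOn.smul hh)
  let V : C(Icc (0 : ℝ) τ, X) → C(Icc (0 : ℝ) τ, X) := fun w =>
    ⟨(Icc 0 τ).domRestrict (rhs w), continuousOn_iff_continuous_domRestrict.1 (hrhs w)⟩
  have hV : ContractingWith (1 / 2) V := by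
    refine ⟨by rw [← NNReal.coe_lt_coe]; norm_num, LipschitzWith.of_dist_le_mul fun v w => ?_⟩
    rw [ContinuousMap.dist_le (by positivity)]
    rintro ⟨t, ht⟩
    have hle : ∀ s ∈ Ioc (0 : ℝ) t, ‖kc (t - s) (Φ s (ext v s)) - kc (t - s) (Φ s (ext w s))‖ ≤
        M * L * dist v w * Real.exp (-(c * (t - s))) := by
      intro s hs
      have h1 : ‖ext v s - ext w s‖ ≤ dist v w := by
        rw [← dist_eq_norm]
        exact ContinuousMap.dist_apply_le_dist _
      have h2 : ‖Φ s (ext v s - ext w s)‖ ≤ L * dist v w :=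
        ((Φ s).le_of_opNorm_le (hΦ s ⟨hs.1.le, hs.2.trans ht.2⟩) _).trans (by gcongr)
      rw [← map_sub, ← map_sub]
      calc ‖kc (t - s) (Φ s (ext v s - ext w s))‖
          ≤ Real.exp (-(c * |t - s|)) * M * (L * dist v w) :=
            ((kc (t - s)).le_of_opNorm_le (hkcn _) _).trans (by gcongr)
        _ = _ := by rw [abs_of_nonneg (sub_nonneg.2 hs.2)]; ring
    calc dist (V v ⟨t, ht⟩) (V w ⟨t, ht⟩)
        = ‖∫ s in (0 : ℝ)..t,
            (kc (t - s) (Φ s (ext v s)) - kc (t - s) (Φ s (ext w s)))‖ := by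
          rw [intervalIntegral.integral_sub
            (intervalIntegrable_convolution hkcM hkc (hextint v) ht)
            (intervalIntegrable_convolution hkcM hkc (hextint w) ht), dist_eq_norm]
          change ‖rhs v t - rhs w t‖ = _
          simp only [rhs, add_sub_add_right_eq_sub]
      _ ≤ ∫ s in (0 : ℝ)..t, M * L * dist v w * Real.exp (-(c * (t - s))) :=
          intervalIntegral.norm_integral_le_of_norm_le ht.1 (Eventually.of_forall hle)
            (Continuous.intervalIntegrable (by fun_prop) _ _)
      _ ≤ M * L * dist v w * c⁻¹ := by
          rw [intervalIntegral.integral_const_mul]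
          exact mul_le_mul_of_nonneg_left (integral_exp_mul_sub_le hc0 t) (by positivity)
      _ = (M * L * c⁻¹) * dist v w := by ring
      _ ≤ ((1 / 2 : NNReal) : ℝ) * dist v w := by
          gcongr
          rw [← div_eq_mul_inv, div_le_iff₀ hc0, hc]
          push_cast
          linarith
  obtain ⟨w, hw⟩ : ∃ w, V w = w := ⟨_, hV.fixedPoint_isFixedPt⟩
  have hw' : ∀ t ∈ Icc (0 : ℝ) τ, ext w t = rhs w t := fun t ht => by
    rw [show ext w t = w ⟨t, ht⟩ from IccExtend_of_mem hτ _ ht]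
    exact (DFunLike.congr_fun hw ⟨t, ht⟩).symm
  refine ⟨fun t => Real.exp (c * t) • ext w t, ?_, fun t ht => ?_⟩
  · have := hext w
    fun_prop
  · simp only
    rw [hw' t ht]
    simp only [rhs]
    rw [smul_add, smul_smul, ← Real.exp_add, add_neg_cancel, Real.exp_zero, one_smul,
      ← intervalIntegral.integral_smul]
    congr 1
    refine intervalIntegral.integral_congr fun s hs => ?_
    rw [uIcc_of_le ht.1] at hs
    simp only [kc, smul_apply, map_smul, smul_smul, ← Real.exp_add]
    rw [abs_of_nonneg (sub_nonneg.2 hs.2)]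
    congr 2
    ring

end Convolution

/-! ### The semigroup as a bounded kernel, and mild solutions. -/

section Semigroup

variable {X : Type*} [NormedAddCommGroup X] [NormedSpace ℝ X]

/-- The semigroup with its time argument clamped to `[0,τ]`: a bounded strongly continuous
operator family on all of `ℝ`. -/
noncomputable def C0Semigroup.clamp (T : C0Semigroup X) (τ t : ℝ) : X →L[ℝ] X :=
  T (max 0 (min t τ))

theorem C0Semigroup.clamp_of_mem (T : C0Semigroup X) {τ t : ℝ} (ht : t ∈ Icc 0 τ) :
    T.clamp τ t = T t := by
  rw [C0Semigroup.clamp, min_eq_left ht.2, max_eq_right ht.1]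

theorem C0Semigroup.continuous_clamp (T : C0Semigroup X) (τ : ℝ) (x : X) :
    Continuous fun t => T.clamp τ t x :=
  (T.continuousOn_orbit x).comp_continuous (f := fun t => max 0 (min t τ)) (by fun_prop)
    fun _ => mem_Ici.2 (le_max_left _ _)

/-- Each orbit is bounded on a compact time interval; uniform boundedness does the rest. -/
theorem C0Semigroup.exists_norm_clamp_le [CompleteSpace X] (T : C0Semigroup X) (τ : ℝ) :
    ∃ M : ℝ, ∀ t, ‖T.clamp τ t‖ ≤ M := by
  refine banach_steinhaus fun x => ?_
  obtain ⟨C, hC⟩ := (isCompact_Icc (a := (0 : ℝ)) (b := max 0 τ)).exists_bound_of_continuousOn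
    ((T.continuousOn_orbit x).mono fun t ht => ht.1)
  exact ⟨C, fun t => hC _ ⟨le_max_left _ _, max_le_max le_rfl (min_le_right _ _)⟩⟩

theorem C0Semigroup.clamp_sub_apply_congr (T : C0Semigroup X) {τ t : ℝ} (ht : t ∈ Icc 0 τ)
    (f : ℝ → X) : ∀ s ∈ Icc 0 t, T.clamp τ (t - s) (f s) = T (t - s) (f s) := fun s hs => by
  rw [T.clamp_of_mem ⟨sub_nonneg.2 hs.2, by linarith [hs.1, ht.2]⟩]

theorem C0Semigroup.integral_clamp (T : C0Semigroup X) {τ t : ℝ} (ht : t ∈ Icc 0 τ)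
    (f : ℝ → X) :
    ∫ s in (0 : ℝ)..t, T.clamp τ (t - s) (f s) = ∫ s in (0 : ℝ)..t, T (t - s) (f s) :=
  intervalIntegral.integral_congr fun s hs => by
    rw [uIcc_of_le ht.1] at hs
    exact T.clamp_sub_apply_congr ht f s hs

theorem C0Semigroup.intervalIntegrable [CompleteSpace X] (T : C0Semigroup X) {τ t : ℝ}
    (ht : t ∈ Icc 0 τ) {f : ℝ → X} (hf : IntegrableOn f (Icc 0 τ)) :
    IntervalIntegrable (fun s => T (t - s) (f s)) volume 0 t := by
  obtain ⟨M, hM⟩ := T.exists_norm_clamp_le τ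
  refine (intervalIntegrable_convolution hM (T.continuous_clamp τ) hf ht).congr fun s hs => ?_
  rw [uIoc_of_le ht.1] at hs
  exact T.clamp_sub_apply_congr ht f s ⟨hs.1.le, hs.2⟩

/-- The variation of constants formula in terms of the clamped semigroup. -/
theorem isMildSolution_iff [CompleteSpace X] (T : C0Semigroup X) {τ : ℝ} {x₀ : X} {f : ℝ → X → X}
    {g x : ℝ → X} (hf : IntegrableOn (fun s => f s (x s)) (Icc 0 τ))
    (hg : IntegrableOn g (Icc 0 τ)) :
    IsMildSolution T τ x₀ f g x ↔ ContinuousOn x (Icc 0 τ) ∧ ∀ t ∈ Icc (0 : ℝ) τ,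
      x t = T t x₀ + (∫ s in (0 : ℝ)..t, T.clamp τ (t - s) (f s (x s)))
        + ∫ s in (0 : ℝ)..t, T.clamp τ (t - s) (g s) := by
  refine and_congr_right fun _ => forall₂_congr fun t ht => ?_
  rw [T.integral_clamp ht, T.integral_clamp ht]
  exact ⟨fun h => h.2.2, fun h => ⟨T.intervalIntegrable ht hf, T.intervalIntegrable ht hg, h⟩⟩

theorem IsMildSolution.apply_zero {T : C0Semigroup X} {τ : ℝ} {x₀ : X} {f : ℝ → X → X}
    {g x : ℝ → X} (h : IsMildSolution T τ x₀ f g x) (hτ : 0 ≤ τ) : x 0 = x₀ := by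
  have := (h.2 0 ⟨le_rfl, hτ⟩).2.2
  simpa [T.map_zero] using this

end Semigroup

/-! ### Linear evolution equations with zero initial value. -/

section Linear

variable {X : Type*} [NormedAddCommGroup X] [NormedSpace ℝ X] {T : C0Semigroup X}
  {Φ : ℝ → X →L[ℝ] X} {τ : ℝ}

theorem IsMildSolution.add_smul {g₁ g₂ y₁ y₂ : ℝ → X} (c : ℝ)
    (h₁ : IsMildSolution T τ 0 (fun s z => Φ s z) g₁ y₁)
    (h₂ : IsMildSolution T τ 0 (fun s z => Φ s z) g₂ y₂) :
    IsMildSolution T τ 0 (fun s z => Φ s z) (fun s => g₁ s + c • g₂ s)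
      (fun s => y₁ s + c • y₂ s) := by
  refine ⟨h₁.1.add (h₂.1.const_smul c), fun t ht => ?_⟩
  obtain ⟨hf₁, hg₁, e₁⟩ := h₁.2 t ht
  obtain ⟨hf₂, hg₂, e₂⟩ := h₂.2 t ht
  have hf₂' : IntervalIntegrable (fun s => c • T (t - s) (Φ s (y₂ s))) volume 0 t := hf₂.smul c
  have hg₂' : IntervalIntegrable (fun s => c • T (t - s) (g₂ s)) volume 0 t := hg₂.smul c
  simp only [map_add, map_smul]
  refine ⟨hf₁.add hf₂', hg₁.add hg₂', ?_⟩
  rw [intervalIntegral.integral_add hf₁ hf₂',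
    intervalIntegral.integral_add hg₁ hg₂', intervalIntegral.integral_smul,
    intervalIntegral.integral_smul, e₁, e₂]
  simp only [map_zero, smul_add, smul_zero]
  abel

/-- A priori bound for linear evolution equations with zero initial value. -/
theorem IsMildSolution.norm_le [CompleteSpace X] {M L : ℝ} (hM : ∀ t, ‖T.clamp τ t‖ ≤ M)
    (hL : 0 ≤ L) (hΦ : ∀ s ∈ Icc (0 : ℝ) τ, ‖Φ s‖ ≤ L)
    (hΦm : ∀ w : ℝ → X, ContinuousOn w (Icc 0 τ) → IntegrableOn (fun s => Φ s (w s)) (Icc 0 τ))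
    {g y : ℝ → X} (hg : IntegrableOn g (Icc 0 τ))
    (h : IsMildSolution T τ 0 (fun s z => Φ s z) g y) {t : ℝ} (ht : t ∈ Icc 0 τ) :
    ‖y t‖ ≤ M * (∫ s in (0 : ℝ)..τ, ‖g s‖) * Real.exp (M * L * τ) := by
  have hM0 : 0 ≤ M := (norm_nonneg _).trans (hM 0)
  have hI : 0 ≤ ∫ s in (0 : ℝ)..τ, ‖g s‖ :=
    intervalIntegral.integral_nonneg (ht.1.trans ht.2) fun _ _ => norm_nonneg _
  have hy := ((isMildSolution_iff T (hΦm y h.1) hg).1 h).2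
  have key := le_mul_exp_of_le_add_integral (φ := fun s => ‖y s‖) (K := M * L)
    (C := M * ∫ s in (0 : ℝ)..τ, ‖g s‖) (by positivity) h.1.norm (fun r hr => ?_) t ht
  · refine key.trans ?_
    gcongr
    exact ht.2
  · have h1 := norm_integral_convolution_le hM (hΦm y h.1) hr
    have h2 : ∫ s in (0 : ℝ)..r, ‖Φ s (y s)‖ ≤ ∫ s in (0 : ℝ)..r, L * ‖y s‖ :=
      intervalIntegral.integral_mono_on hr.1
        (intervalIntegrable_of_integrableOn_Icc (hΦm y h.1).norm hr)
        (intervalIntegrable_of_integrableOn_Icc (h.1.norm.integrableOn_Icc.const_mul L) hr)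
        fun s hs => (Φ s).le_of_opNorm_le (hΦ s ⟨hs.1, hs.2.trans hr.2⟩) _
    rw [intervalIntegral.integral_const_mul] at h2
    have h3 := norm_integral_convolution_le' hM hg hr
    simp only [hy r hr, map_zero, zero_add]
    calc _ ≤ _ := norm_add_le _ _
      _ ≤ M * (L * ∫ s in (0 : ℝ)..r, ‖y s‖) + M * ∫ s in (0 : ℝ)..τ, ‖g s‖ :=
        add_le_add (h1.trans (by gcongr)) h3
      _ = _ := by ring

/-- The difference of two solutions solves the equation with zero forcing, so the a priori bound
vanishes. -/
theorem IsMildSolution.eqOn [CompleteSpace X] {L : ℝ} (hΦ : ∀ s ∈ Icc (0 : ℝ) τ, ‖Φ s‖ ≤ L)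
    (hΦm : ∀ w : ℝ → X, ContinuousOn w (Icc 0 τ) → IntegrableOn (fun s => Φ s (w s)) (Icc 0 τ))
    {g y z : ℝ → X} (hy : IsMildSolution T τ 0 (fun s z => Φ s z) g y)
    (hz : IsMildSolution T τ 0 (fun s z => Φ s z) g z) : EqOn z y (Icc 0 τ) := by
  intro t ht
  obtain ⟨M, hM⟩ := T.exists_norm_clamp_le τ
  have h := hz.add_smul (-1) hy
  simp only [neg_smul, one_smul, add_neg_cancel] at h
  have := h.norm_le hM ((norm_nonneg _).trans (hΦ t ht)) hΦ hΦm integrableOn_zero ht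
  simp only [norm_zero, intervalIntegral.integral_zero, mul_zero, zero_mul, norm_le_zero_iff]
    at this
  exact eq_of_sub_eq_zero (by rwa [sub_eq_add_neg])

theorem exists_isMildSolution_linear [CompleteSpace X] (T : C0Semigroup X) (hτ : 0 ≤ τ) {L : ℝ}
    (hΦ : ∀ s ∈ Icc (0 : ℝ) τ, ‖Φ s‖ ≤ L)
    (hΦm : ∀ w : ℝ → X, ContinuousOn w (Icc 0 τ) → IntegrableOn (fun s => Φ s (w s)) (Icc 0 τ))
    {g : ℝ → X} (hg : IntegrableOn g (Icc 0 τ)) :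
    ∃ y, IsMildSolution T τ 0 (fun s z => Φ s z) g y := by
  obtain ⟨M, hM⟩ := T.exists_norm_clamp_le τ
  obtain ⟨y, hyc, hy⟩ := exists_linear_volterra hτ hM (T.continuous_clamp τ) hΦ hΦm
    (continuousOn_integral_convolution hM (T.continuous_clamp τ) hg)
  refine ⟨y, (isMildSolution_iff T (hΦm y hyc) hg).2 ⟨hyc, fun t ht => ?_⟩⟩
  rw [map_zero, zero_add, ← hy t ht]

end Linear

/-! ### The nonlinearity along continuous curves. -/

section Nemytskii

theorem continuous_of_lipschitz_on_balls {X : Type*} [NormedAddCommGroup X] {F : X → X}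
    (hF : ∀ δ : ℝ, 0 < δ → ∃ L : ℝ, 0 < L ∧ ∀ x₁ x₂ : X, ‖x₁‖ ≤ δ → ‖x₂‖ ≤ δ →
      ‖F x₂ - F x₁‖ ≤ L * ‖x₂ - x₁‖) : Continuous F := by
  rw [continuous_iff_continuousAt]
  intro x
  obtain ⟨L, hL, h⟩ := hF (‖x‖ + 1) (by positivity)
  have hlip : LipschitzOnWith ⟨L, hL.le⟩ F (Metric.ball 0 (‖x‖ + 1)) :=
    LipschitzOnWith.of_dist_le_mul fun a ha b hb => by
      rw [dist_eq_norm, dist_eq_norm]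
      exact h b a (mem_ball_zero_iff.1 hb).le (mem_ball_zero_iff.1 ha).le
  exact hlip.continuousOn.continuousAt (Metric.isOpen_ball.mem_nhds (by simp))

theorem HasGateauxDerivAt.tendsto_slope_zero {E G : Type*} [NormedAddCommGroup E]
    [NormedSpace ℝ E] [NormedAddCommGroup G] [NormedSpace ℝ G] {f : E → G} {f' : E →L[ℝ] G}
    {x : E} (hf : HasGateauxDerivAt f f' x) (h : E) :
    Tendsto (fun ε : ℝ => ε⁻¹ • (f (x + ε • h) - f x)) (𝓝[≠] 0) (𝓝 (f' h)) :=
  HasLineDerivAt.tendsto_slope_zero (hf h)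

variable {X : Type*} [NormedAddCommGroup X] [NormedSpace ℝ X] {F : X → X} {F' : X → X →L[ℝ] X}

/-- Along a continuous curve, the Gateaux derivative of a continuous map which is bounded on
bounded sets acts on continuous curves with values in the integrable functions. -/
theorem integrableOn_gateauxDeriv_apply (hFc : Continuous F)
    (hF' : ∀ x, HasGateauxDerivAt F (F' x) x) {τ L : ℝ} {x y : ℝ → X}
    (hx : ContinuousOn x (Icc 0 τ)) (hy : ContinuousOn y (Icc 0 τ))
    (hL : ∀ s ∈ Icc (0 : ℝ) τ, ‖F' (x s)‖ ≤ L) :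
    IntegrableOn (fun s => F' (x s) (y s)) (Icc 0 τ) := by
  refine (hy.norm.integrableOn_Icc.const_mul L).mono' ?_ ?_
  -- `F'` has no assumed continuity; measurability comes from writing the integrand as a pointwise
  -- limit of difference quotients, each continuous in `s`.
  · refine aestronglyMeasurable_of_tendsto_ae (𝓝[≠] (0 : ℝ))
      (f := fun ε s => ε⁻¹ • (F (x s + ε • y s) - F (x s))) (fun ε => ?_)
      (Eventually.of_forall fun s => (hF' (x s)).tendsto_slope_zero (y s))
    refine ContinuousOn.aestronglyMeasurable_of_isCompact ?_ isCompact_Icc measurableSet_Icc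
    fun_prop
  · exact (ae_restrict_iff' measurableSet_Icc).2
      (Eventually.of_forall fun s hs => (F' (x s)).le_of_opNorm_le (hL s hs) _)

/-- The linearization error of the nonlinearity along continuous curves vanishes in `L¹`. -/
theorem tendsto_integral_norm_quotient_sub {τ L L' ρ : ℝ} (hτ : 0 ≤ τ) (hFc : Continuous F)
    (hF' : ∀ x, HasGateauxDerivAt F (F' x) x) {x y : ℝ → X}
    (hxc : ContinuousOn x (Icc 0 τ)) (hyc : ContinuousOn y (Icc 0 τ))
    (hL' : ∀ s ∈ Icc (0 : ℝ) τ, ‖F' (x s)‖ ≤ L')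
    (hFL : ∀ z₁ z₂ : X, ‖z₁‖ ≤ ρ → ‖z₂‖ ≤ ρ → ‖F z₂ - F z₁‖ ≤ L * ‖z₂ - z₁‖)
    (hρ : ∀ᶠ ε in 𝓝[≠] (0 : ℝ), ∀ t ∈ Icc (0 : ℝ) τ, ‖x t + ε • y t‖ ≤ ρ)
    (hρ₀ : ∀ t ∈ Icc (0 : ℝ) τ, ‖x t‖ ≤ ρ) :
    Tendsto (fun ε : ℝ => ∫ s in (0 : ℝ)..τ,
      ‖ε⁻¹ • (F (x s + ε • y s) - F (x s)) - F' (x s) (y s)‖) (𝓝[≠] 0) (𝓝 0) := by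
  have hτ' : τ ∈ Icc 0 τ := ⟨hτ, le_rfl⟩
  have hΦi := integrableOn_gateauxDeriv_apply hFc hF' hxc hyc hL'
  have h := intervalIntegral.tendsto_integral_filter_of_dominated_convergence
    (μ := volume) (a := 0) (b := τ) (l := 𝓝[≠] (0 : ℝ))
    (F := fun ε s => ‖ε⁻¹ • (F (x s + ε • y s) - F (x s)) - F' (x s) (y s)‖) (f := fun _ => 0)
    -- In the majorant, `L` controls the difference quotient and `L'` the derivative.
    (fun s => (L + L') * ‖y s‖) ?_ ?_ ?_ ?_
  · simpa using h
  · refine Eventually.of_forall fun ε => ?_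
    have : IntegrableOn (fun s => ε⁻¹ • (F (x s + ε • y s) - F (x s)) - F' (x s) (y s))
        (Icc 0 τ) := by
      refine Integrable.sub (ContinuousOn.integrableOn_Icc ?_) hΦi
      fun_prop
    exact (intervalIntegrable_of_integrableOn_Icc this.norm hτ').aestronglyMeasurable_restrict_uIoc
  · filter_upwards [hρ, self_mem_nhdsWithin] with ε hε hne
    refine Eventually.of_forall fun s hs => ?_
    rw [uIoc_of_le hτ] at hs
    have hs' := Ioc_subset_Icc_self hs
    have h1 := hFL _ _ (hρ₀ s hs') (hε s hs')
    rw [add_sub_cancel_left, norm_smul] at h1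
    have h2 := (F' (x s)).le_of_opNorm_le (hL' s hs') (y s)
    have h0 : 0 < ‖ε‖ := norm_pos_iff.2 hne
    rw [norm_norm, add_mul]
    refine (norm_sub_le _ _).trans (add_le_add ?_ h2)
    rw [norm_smul, norm_inv, inv_mul_le_iff₀ h0]
    linarith
  · exact intervalIntegrable_of_integrableOn_Icc (hyc.norm.integrableOn_Icc.const_mul _) hτ'
  · refine Eventually.of_forall fun s _ => ?_
    have := ((hF' (x s)).tendsto_slope_zero (y s)).sub_const (F' (x s) (y s))
    simpa using this.norm

end Nemytskii

/-! ### Integrability of the inputs. -/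

section Inputs

theorem integrableOn_L2 {E : Type*} [NormedAddCommGroup E] {τ : ℝ} (u : L2 τ E) :
    IntegrableOn u (Icc 0 τ) :=
  (Lp.memLp u).integrable one_le_two

theorem integral_norm_nonneg {E : Type*} [NormedAddCommGroup E] {τ : ℝ} (u : L2 τ E) (hτ : 0 ≤ τ) : 0 ≤ ∫ s in (0 : ℝ)..τ, ‖u s‖ :=
  intervalIntegral.integral_nonneg hτ fun _ _ => norm_nonneg _

variable {X U : Type*} [NormedAddCommGroup X] [NormedSpace ℝ X]
  [NormedAddCommGroup U] [NormedSpace ℝ U] {τ : ℝ}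

theorem integrableOn_comp_L2 (b : U →L[ℝ] X) (u : L2 τ U) :
    IntegrableOn (fun s => b (u s)) (Icc 0 τ) :=
  b.integrable_comp (integrableOn_L2 u)

theorem integral_norm_apply_le (b : U →L[ℝ] X) (u : L2 τ U) (hτ : 0 ≤ τ) :
    ∫ s in (0 : ℝ)..τ, ‖b (u s)‖ ≤ ‖b‖ * ∫ s in (0 : ℝ)..τ, ‖u s‖ := by
  have hτ' : τ ∈ Icc 0 τ := ⟨hτ, le_rfl⟩
  rw [← intervalIntegral.integral_const_mul]
  exact intervalIntegral.integral_mono_on hτ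
    (intervalIntegrable_of_integrableOn_Icc (integrableOn_comp_L2 b u).norm hτ')
    (intervalIntegrable_of_integrableOn_Icc ((integrableOn_L2 u).norm.const_mul _) hτ')
    fun s _ => b.le_opNorm _

end Inputs

/-! ### Comparison of states for two input operators. -/

section States

variable {X U : Type*} [NormedAddCommGroup X] [NormedSpace ℝ X] [CompleteSpace X]
  [NormedAddCommGroup U] [NormedSpace ℝ U] {T : C0Semigroup X} {F : X → X}
  {τ M L ρ : ℝ} {x₀ : X} {b₀ b₁ : U →L[ℝ] X} {u : L2 τ U} {x x₁ : ℝ → X}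

theorem IsMildState.eq_clamp (hFc : Continuous F) (h : IsMildState T F τ x₀ b₀ u x) {t : ℝ}
    (ht : t ∈ Icc 0 τ) :
    x t = T t x₀ + (∫ s in (0 : ℝ)..t, T.clamp τ (t - s) (F (x s)))
        + ∫ s in (0 : ℝ)..t, T.clamp τ (t - s) (b₀ (u s)) :=
  ((isMildSolution_iff T (hFc.comp_continuousOn h.1).integrableOn_Icc
    (integrableOn_comp_L2 b₀ u)).1 h).2 t ht

theorem IsMildState.sub_eq (hFc : Continuous F) (h₀ : IsMildState T F τ x₀ b₀ u x)
    (h₁ : IsMildState T F τ x₀ b₁ u x₁) {t : ℝ} (ht : t ∈ Icc 0 τ) :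
    x₁ t - x t = (∫ s in (0 : ℝ)..t, T.clamp τ (t - s) (F (x₁ s) - F (x s)))
        + ∫ s in (0 : ℝ)..t, T.clamp τ (t - s) ((b₁ - b₀) (u s)) := by
  obtain ⟨M, hM⟩ := T.exists_norm_clamp_le τ
  have hF : ∀ z : ℝ → X, ContinuousOn z (Icc 0 τ) →
      IntervalIntegrable (fun s => T.clamp τ (t - s) (F (z s))) volume 0 t :=
    fun z hz => intervalIntegrable_convolution hM (T.continuous_clamp τ) (hFc.comp_continuousOn hz).integrableOn_Icc ht
  have hb := fun b : U →L[ℝ] X => intervalIntegrable_convolution hM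
    (T.continuous_clamp τ) (integrableOn_comp_L2 b u) ht
  rw [h₀.eq_clamp hFc ht, h₁.eq_clamp hFc ht]
  simp only [sub_apply, map_sub]
  rw [intervalIntegral.integral_sub (hF _ h₁.1) (hF _ h₀.1),
    intervalIntegral.integral_sub (hb b₁) (hb b₀)]
  abel

/-- A small change of the input operator keeps the state within distance one, if the nonlinearity
is Lipschitz on a ball containing the unit neighbourhood of the original trajectory. -/
theorem IsMildState.norm_sub_le_one (hτ : 0 ≤ τ) (hM : ∀ t, ‖T.clamp τ t‖ ≤ M)
    (hFc : Continuous F) (hL : 0 ≤ L)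
    (hFL : ∀ z₁ z₂ : X, ‖z₁‖ ≤ ρ + 1 → ‖z₂‖ ≤ ρ + 1 → ‖F z₂ - F z₁‖ ≤ L * ‖z₂ - z₁‖)
    (h₀ : IsMildState T F τ x₀ b₀ u x) (h₁ : IsMildState T F τ x₀ b₁ u x₁)
    (hρ : ∀ t ∈ Icc (0 : ℝ) τ, ‖x t‖ ≤ ρ)
    (hb : M * (‖b₁ - b₀‖ * ∫ s in (0 : ℝ)..τ, ‖u s‖) * Real.exp (M * L * τ) < 1)
    {t : ℝ} (ht : t ∈ Icc 0 τ) : ‖x₁ t - x t‖ ≤ 1 := by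
  have hM0 : 0 ≤ M := (norm_nonneg _).trans (hM 0)
  have hI := integral_norm_nonneg u hτ
  -- Otherwise there is a first time `c` at which the distance equals one. Up to `c` both states lie
  -- in the ball where `F` is Lipschitz, so Gronwall on `[0,c]` and `hb` force the distance at `c`
  -- below one.
  by_contra! hlt
  set φ : ℝ → ℝ := fun t => ‖x₁ t - x t‖ with hφ
  have hφc : ContinuousOn φ (Icc 0 τ) := (h₁.1.sub h₀.1).norm
  have hφ0 : φ 0 = 0 := by
    simp only [hφ]
    rw [IsMildSolution.apply_zero h₀ hτ, IsMildSolution.apply_zero h₁ hτ, sub_self, norm_zero]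
  have hivt : ∀ s ∈ Icc (0 : ℝ) τ, 1 < φ s → ∃ c ∈ Icc (0 : ℝ) s, φ c = 1 := fun s hs h =>
    intermediate_value_Icc hs.1 (hφc.mono (Icc_subset_Icc_right hs.2))
      ⟨by rw [hφ0]; exact zero_le_one, h.le⟩
  have hcomp : IsCompact (Icc 0 τ ∩ φ ⁻¹' {1}) :=
    isCompact_Icc.of_isClosed_subset
      (hφc.preimage_isClosed_of_isClosed isClosed_Icc isClosed_singleton) inter_subset_left
  obtain ⟨c, ⟨hc, hc1⟩, hmin⟩ := hcomp.exists_isLeast (by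
    obtain ⟨c, hc, h⟩ := hivt t ht hlt
    exact ⟨c, ⟨hc.1, hc.2.trans ht.2⟩, h⟩)
  have hc1 : φ c = 1 := hc1
  have hle : ∀ s ∈ Icc (0 : ℝ) c, φ s ≤ 1 := by
    intro s hs
    by_contra! h
    have hs' : s ∈ Icc 0 τ := ⟨hs.1, hs.2.trans hc.2⟩
    obtain ⟨r, hr, hr1⟩ := hivt s hs' h
    have h2 := hmin ⟨⟨hr.1, hr.2.trans hs'.2⟩, hr1⟩
    have : s = c := le_antisymm hs.2 (h2.trans hr.2)
    rw [this] at h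
    linarith
  have key := le_mul_exp_of_le_add_integral (φ := φ) (τ := c) (K := M * L)
    (C := M * (‖b₁ - b₀‖ * ∫ s in (0 : ℝ)..τ, ‖u s‖)) (by positivity)
    (hφc.mono (Icc_subset_Icc_right hc.2)) (fun r hr => ?_) c ⟨hc.1, le_rfl⟩
  · have : M * (‖b₁ - b₀‖ * ∫ s in (0 : ℝ)..τ, ‖u s‖) * Real.exp (M * L * c) ≤
        M * (‖b₁ - b₀‖ * ∫ s in (0 : ℝ)..τ, ‖u s‖) * Real.exp (M * L * τ) := by
      gcongr
      exact hc.2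
    linarith
  · have hr' : r ∈ Icc 0 τ := ⟨hr.1, hr.2.trans hc.2⟩
    have hFi : IntegrableOn (fun s => F (x₁ s) - F (x s)) (Icc 0 τ) :=
      ((hFc.comp_continuousOn h₁.1).sub (hFc.comp_continuousOn h₀.1)).integrableOn_Icc
    have i1 := norm_integral_convolution_le hM hFi hr'
    have i2 : ∫ s in (0 : ℝ)..r, ‖F (x₁ s) - F (x s)‖ ≤ ∫ s in (0 : ℝ)..r, L * φ s :=
      intervalIntegral.integral_mono_on hr.1 (intervalIntegrable_of_integrableOn_Icc hFi.norm hr')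
        (intervalIntegrable_of_integrableOn_Icc (hφc.integrableOn_Icc.const_mul L) hr')
        fun s hs => by
          have hxs := hρ s ⟨hs.1, hs.2.trans hr'.2⟩
          have hφs : ‖x₁ s - x s‖ ≤ 1 := hle s ⟨hs.1, hs.2.trans hr.2⟩
          refine hFL _ _ (by linarith) ?_
          have := norm_add_le (x s) (x₁ s - x s)
          rw [add_sub_cancel] at this
          linarith
    rw [intervalIntegral.integral_const_mul] at i2
    have i3 := (norm_integral_convolution_le' hM (integrableOn_comp_L2 (b₁ - b₀) u) hr').trans
      (mul_le_mul_of_nonneg_left (integral_norm_apply_le _ u hτ) hM0)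
    simp only [hφ]
    rw [h₀.sub_eq hFc h₁ hr']
    calc _ ≤ _ := norm_add_le _ _
      _ ≤ M * (L * ∫ s in (0 : ℝ)..r, φ s) + M * (‖b₁ - b₀‖ * ∫ s in (0 : ℝ)..τ, ‖u s‖) :=
        add_le_add (i1.trans (by gcongr)) i3
      _ = _ := by ring

/-- Distance between a difference quotient of states and the solution of the linearization. -/
theorem IsMildState.norm_quotient_sub_le (hτ : 0 ≤ τ) (hM : ∀ t, ‖T.clamp τ t‖ ≤ M)
    (hFc : Continuous F) (hL : 0 ≤ L)
    (hFL : ∀ z₁ z₂ : X, ‖z₁‖ ≤ ρ → ‖z₂‖ ≤ ρ → ‖F z₂ - F z₁‖ ≤ L * ‖z₂ - z₁‖)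
    (h₀ : IsMildState T F τ x₀ b₀ u x) (h₁ : IsMildState T F τ x₀ b₁ u x₁)
    {Φ : ℝ → X →L[ℝ] X}
    (hΦm : ∀ w : ℝ → X, ContinuousOn w (Icc 0 τ) → IntegrableOn (fun s => Φ s (w s)) (Icc 0 τ))
    {b' : U →L[ℝ] X} {y : ℝ → X}
    (hy : IsMildSolution T τ 0 (fun s z => Φ s z) (fun s => b' (u s)) y) {ε : ℝ} (hε : ε ≠ 0)
    (hρ₁ : ∀ t ∈ Icc (0 : ℝ) τ, ‖x₁ t‖ ≤ ρ) (hρ : ∀ t ∈ Icc (0 : ℝ) τ, ‖x t + ε • y t‖ ≤ ρ)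
    {t : ℝ} (ht : t ∈ Icc 0 τ) :
    ‖ε⁻¹ • (x₁ t - x t) - y t‖ ≤
      M * ((∫ s in (0 : ℝ)..τ, ‖ε⁻¹ • (F (x s + ε • y s) - F (x s)) - Φ s (y s)‖)
        + ‖ε⁻¹ • (b₁ - b₀) - b'‖ * ∫ s in (0 : ℝ)..τ, ‖u s‖) * Real.exp (M * L * τ) := by
  have hM0 : 0 ≤ M := (norm_nonneg _).trans (hM 0)
  have hI := integral_norm_nonneg u hτ
  set q : ℝ → X := fun s => ε⁻¹ • (F (x s + ε • y s) - F (x s)) - Φ s (y s) with hq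
  set d : ℝ → X := fun s => ε⁻¹ • (x₁ s - x s) - y s with hd
  set Q : ℝ := ∫ s in (0 : ℝ)..τ, ‖q s‖ with hQ
  have hQ0 : 0 ≤ Q := intervalIntegral.integral_nonneg hτ fun _ _ => norm_nonneg _
  have hxc : ContinuousOn x (Icc 0 τ) := h₀.1
  have hx₁c : ContinuousOn x₁ (Icc 0 τ) := h₁.1
  have hyc : ContinuousOn y (Icc 0 τ) := hy.1
  have hdc : ContinuousOn d (Icc 0 τ) := by fun_prop
  have hqi : IntegrableOn q (Icc 0 τ) := by
    refine Integrable.sub (ContinuousOn.integrableOn_Icc ?_) (hΦm y hyc)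
    fun_prop
  have hFi : IntegrableOn (fun s => F (x₁ s) - F (x s)) (Icc 0 τ) :=
    ContinuousOn.integrableOn_Icc (by fun_prop)
  let p : ℝ → X := fun s => ε⁻¹ • (F (x₁ s) - F (x s)) - Φ s (y s)
  have hpi : IntegrableOn p (Icc 0 τ) := (hFi.smul ε⁻¹).sub (hΦm y hyc)
  -- Inserting `F (x s + ε • y s)` separates a Lipschitz part, proportional to `d`, from the
  -- linearization error `q`.
  have hple : ∀ s ∈ Icc (0 : ℝ) τ, ‖p s‖ ≤ L * ‖d s‖ + ‖q s‖ := by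
    intro s hs
    have e1 : p s = ε⁻¹ • (F (x₁ s) - F (x s + ε • y s)) + q s := by
      simp only [p, hq, smul_sub]
      abel
    have e2 : x₁ s - (x s + ε • y s) = ε • d s := by
      simp only [hd, smul_sub, smul_inv_smul₀ hε]
      abel
    have e3 := hFL _ _ (hρ s hs) (hρ₁ s hs)
    rw [e2, norm_smul] at e3
    rw [e1]
    refine (norm_add_le _ _).trans (add_le_add_left ?_ _)
    rw [norm_smul, norm_inv]
    have : 0 < ‖ε‖ := norm_pos_iff.2 hε
    rw [inv_mul_le_iff₀ this]
    linarith
  have heq : ∀ r ∈ Icc (0 : ℝ) τ, d r = (∫ s in (0 : ℝ)..r, T.clamp τ (r - s) (p s)) +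
      ∫ s in (0 : ℝ)..r, T.clamp τ (r - s) ((ε⁻¹ • (b₁ - b₀) - b') (u s)) := by
    intro r hr
    have hconv : ∀ f : ℝ → X, IntegrableOn f (Icc 0 τ) →
        IntervalIntegrable (fun s => T.clamp τ (r - s) (f s)) volume 0 r :=
      fun f hf => intervalIntegrable_convolution hM (T.continuous_clamp τ) hf hr
    have hsplit : ∀ f g : ℝ → X, IntegrableOn f (Icc 0 τ) → IntegrableOn g (Icc 0 τ) →
        ∫ s in (0 : ℝ)..r, T.clamp τ (r - s) (ε⁻¹ • f s - g s) =
          ε⁻¹ • (∫ s in (0 : ℝ)..r, T.clamp τ (r - s) (f s))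
            - ∫ s in (0 : ℝ)..r, T.clamp τ (r - s) (g s) := fun f g hf hg => by
      have hf' : IntervalIntegrable (fun s => ε⁻¹ • T.clamp τ (r - s) (f s)) volume 0 r :=
        (hconv f hf).smul ε⁻¹
      simp only [map_sub, map_smul]
      rw [intervalIntegral.integral_sub hf' (hconv g hg), intervalIntegral.integral_smul]
    have hyr := ((isMildSolution_iff T (hΦm y hyc) (integrableOn_comp_L2 b' u)).1 hy).2 r hr
    have hp := hsplit _ _ hFi (hΦm y hyc)
    have hu := hsplit _ _ (integrableOn_comp_L2 (b₁ - b₀) u) (integrableOn_comp_L2 b' u)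
    have hu' : ∀ s, (ε⁻¹ • (b₁ - b₀) - b') (u s) = ε⁻¹ • (b₁ - b₀) (u s) - b' (u s) :=
      fun s => rfl
    simp only [hu', p]
    rw [hp, hu]
    simp only [hd]
    rw [h₀.sub_eq hFc h₁ hr, hyr, map_zero, zero_add, smul_add]
    abel
  have key := le_mul_exp_of_le_add_integral (φ := fun s => ‖d s‖) (K := M * L)
    (C := M * (Q + ‖ε⁻¹ • (b₁ - b₀) - b'‖ * ∫ s in (0 : ℝ)..τ, ‖u s‖))
    (by positivity) hdc.norm (fun r hr => ?_) t ht
  · refine key.trans ?_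
    gcongr
    exact ht.2
  · have i1 := norm_integral_convolution_le hM hpi hr
    have hdi := intervalIntegrable_of_integrableOn_Icc (hdc.norm.integrableOn_Icc.const_mul L) hr
    have hqi' := intervalIntegrable_of_integrableOn_Icc hqi.norm hr
    have i2 : ∫ s in (0 : ℝ)..r, ‖p s‖ ≤ ∫ s in (0 : ℝ)..r, (L * ‖d s‖ + ‖q s‖) :=
      intervalIntegral.integral_mono_on hr.1 (intervalIntegrable_of_integrableOn_Icc hpi.norm hr)
        (hdi.add hqi') fun s hs => hple s ⟨hs.1, hs.2.trans hr.2⟩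
    rw [intervalIntegral.integral_add hdi hqi', intervalIntegral.integral_const_mul] at i2
    have i3 := integral_mono_horizon hqi.norm (fun _ => norm_nonneg _) hr
    have i4 := (norm_integral_convolution_le' hM
      (integrableOn_comp_L2 (ε⁻¹ • (b₁ - b₀) - b') u) hr).trans
      (mul_le_mul_of_nonneg_left (integral_norm_apply_le _ u hτ) hM0)
    calc ‖d r‖ ≤ _ := by
          rw [heq r hr]
          exact norm_add_le _ _
      _ ≤ M * (L * (∫ s in (0 : ℝ)..r, ‖d s‖) + Q)
          + M * (‖ε⁻¹ • (b₁ - b₀) - b'‖ * ∫ s in (0 : ℝ)..τ, ‖u s‖) :=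
        add_le_add (i1.trans (by gcongr; exact i2.trans (by gcongr))) i4
      _ = _ := by ring

end States

/-- At an interior point, a Gateaux derivative on a set gives convergence of unrestricted
difference quotients, continuity along lines, and membership of nearby points of the line. -/
theorem HasGateauxDerivWithinAt.tendsto_of_mem_interior {E G : Type*} [NormedAddCommGroup E] [NormedSpace ℝ E]
    [NormedAddCommGroup G] [NormedSpace ℝ G] {f : E → G} {f' : E →L[ℝ] G} {s : Set E} {x : E}
    (hf : HasGateauxDerivWithinAt f f' s x) (hx : x ∈ interior s) (h : E) :
    Tendsto (fun ε : ℝ => ε⁻¹ • (f (x + ε • h) - f x)) (𝓝[≠] 0) (𝓝 (f' h)) ∧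
      Tendsto (fun ε : ℝ => f (x + ε • h) - f x) (𝓝[≠] 0) (𝓝 0) ∧
      ∀ᶠ ε in 𝓝[≠] (0 : ℝ), x + ε • h ∈ s := by
  have hline : Tendsto (fun ε : ℝ => x + ε • h) (𝓝 0) (𝓝 x) := by
    have : Continuous fun ε : ℝ => x + ε • h := by fun_prop
    simpa using this.tendsto 0
  have hmem : ∀ᶠ ε in 𝓝 (0 : ℝ), x + ε • h ∈ s := hline (mem_interior_iff_mem_nhds.1 hx)
  have hd : HasDerivAt (fun ε : ℝ => f (x + ε • h)) (f' h) 0 :=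
    HasDerivWithinAt.hasDerivAt (hf h) hmem
  refine ⟨?_, ?_, hmem.filter_mono nhdsWithin_le_nhds⟩
  · simpa using hd.tendsto_slope_zero
  · have := (hd.continuousAt.tendsto.sub_const (f x)).mono_left
      (nhdsWithin_le_nhds (s := {0}ᶜ))
    simpa using this

/-! ### Convergence of the quotients and the derivative operator. -/

section Main

variable {X U : Type*} [NormedAddCommGroup X] [NormedSpace ℝ X] [CompleteSpace X]
  [NormedAddCommGroup U] [NormedSpace ℝ U]

/-- Uniform convergence of difference quotients of states to the solution of the linearized
equation, for a family of input operators differentiable at `ε = 0`. -/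
theorem exists_tendsto_norm_quotient_sub_le {T : C0Semigroup X} {F : X → X}
    {F' : X → X →L[ℝ] X} {τ : ℝ} {x₀ : X} {u : L2 τ U} (hτ : 0 ≤ τ)
    (hFlip : ∀ δ : ℝ, 0 < δ → ∃ L : ℝ, 0 < L ∧ ∀ x₁ x₂ : X, ‖x₁‖ ≤ δ → ‖x₂‖ ≤ δ →
      ‖F x₂ - F x₁‖ ≤ L * ‖x₂ - x₁‖)
    (hF' : ∀ x : X, HasGateauxDerivAt F (F' x) x) {b₀ b' : U →L[ℝ] X} {b : ℝ → U →L[ℝ] X}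
    {x y : ℝ → X} {xε : ℝ → ℝ → X} {L' : ℝ} (hL' : ∀ s ∈ Icc (0 : ℝ) τ, ‖F' (x s)‖ ≤ L')
    (hx : IsMildState T F τ x₀ b₀ u x)
    (hxε : ∀ᶠ ε in 𝓝[≠] (0 : ℝ), IsMildState T F τ x₀ (b ε) u (xε ε))
    (hb : Tendsto (fun ε => b ε - b₀) (𝓝[≠] 0) (𝓝 0))
    (hb' : Tendsto (fun ε => ε⁻¹ • (b ε - b₀)) (𝓝[≠] 0) (𝓝 b'))
    (hy : IsMildSolution T τ 0 (fun s z => F' (x s) z) (fun s => b' (u s)) y) :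
    ∃ C : ℝ → ℝ, Tendsto C (𝓝[≠] 0) (𝓝 0) ∧ ∀ᶠ ε in 𝓝[≠] (0 : ℝ),
      ∀ t ∈ Icc (0 : ℝ) τ, ‖ε⁻¹ • (xε ε t - x t) - y t‖ ≤ C ε := by
  have hFc := continuous_of_lipschitz_on_balls hFlip
  obtain ⟨M, hM⟩ := T.exists_norm_clamp_le τ
  obtain ⟨ρ, hρ⟩ := isCompact_Icc.exists_bound_of_continuousOn hx.1
  obtain ⟨η, hη⟩ := isCompact_Icc.exists_bound_of_continuousOn hy.1
  have hρ0 : 0 ≤ ρ := (norm_nonneg _).trans (hρ 0 ⟨le_rfl, hτ⟩)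
  -- The unit margin accommodates both `x + ε y` and the perturbed states for small `ε`.
  obtain ⟨L, hL, hFL⟩ := hFlip (ρ + 1) (by positivity)
  have hΦm : ∀ w : ℝ → X, ContinuousOn w (Icc 0 τ) →
      IntegrableOn (fun s => F' (x s) (w s)) (Icc 0 τ) :=
    fun w hw => integrableOn_gateauxDeriv_apply hFc hF' hx.1 hw hL'
  have hsmall : ∀ᶠ ε in 𝓝[≠] (0 : ℝ), ∀ t ∈ Icc (0 : ℝ) τ, ‖x t + ε • y t‖ ≤ ρ + 1 := by
    have h0 : Tendsto (fun ε : ℝ => ‖ε‖ * η) (𝓝[≠] 0) (𝓝 0) := by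
      have : Continuous fun ε : ℝ => ‖ε‖ * η := by fun_prop
      simpa using (this.tendsto 0).mono_left (nhdsWithin_le_nhds (s := {0}ᶜ))
    filter_upwards [h0.eventually (gt_mem_nhds one_pos)] with ε hε t ht
    refine (norm_add_le _ _).trans (add_le_add (hρ t ht) ?_)
    rw [norm_smul]
    exact (mul_le_mul_of_nonneg_left (hη t ht) (norm_nonneg _)).trans hε.le
  have hclose : ∀ᶠ ε in 𝓝[≠] (0 : ℝ),
      M * (‖b ε - b₀‖ * ∫ s in (0 : ℝ)..τ, ‖u s‖) * Real.exp (M * L * τ) < 1 := by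
    have := ((hb.norm.mul_const (∫ s in (0 : ℝ)..τ, ‖u s‖)).const_mul M).mul_const
      (Real.exp (M * L * τ))
    simp only [norm_zero, zero_mul, mul_zero] at this
    exact this.eventually (gt_mem_nhds one_pos)
  refine ⟨fun ε => M * ((∫ s in (0 : ℝ)..τ,
      ‖ε⁻¹ • (F (x s + ε • y s) - F (x s)) - F' (x s) (y s)‖)
      + ‖ε⁻¹ • (b ε - b₀) - b'‖ * ∫ s in (0 : ℝ)..τ, ‖u s‖) * Real.exp (M * L * τ), ?_, ?_⟩
  · have h1 := tendsto_integral_norm_quotient_sub hτ hFc hF' hx.1 hy.1 hL' hFL hsmall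
      fun t ht => (hρ t ht).trans (by linarith)
    have h2 := ((hb'.sub_const b').norm).mul_const (∫ s in (0 : ℝ)..τ, ‖u s‖)
    simpa using ((h1.add h2).const_mul M).mul_const (Real.exp (M * L * τ))
  · filter_upwards [hxε, hsmall, hclose, self_mem_nhdsWithin] with ε h₁ hρy hε hne t ht
    refine hx.norm_quotient_sub_le hτ hM hFc hL.le hFL h₁ hΦm hy hne (fun s hs => ?_) hρy ht
    have h1 := hx.norm_sub_le_one hτ hM hFc hL.le hFL h₁ hρ hε hs
    have h2 := norm_add_le (x s) (xε ε s - x s)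
    rw [add_sub_cancel] at h2
    linarith [hρ s hs]

theorem memLp_of_continuousOn {E : Type*} [NormedAddCommGroup E] {τ : ℝ} {x : ℝ → E}
    (hx : ContinuousOn x (Icc 0 τ)) : MemLp x 2 (volume.restrict (Icc 0 τ)) := by
  obtain ⟨C, hC⟩ := isCompact_Icc.exists_bound_of_continuousOn hx
  exact MemLp.of_bound (hx.aestronglyMeasurable_of_isCompact isCompact_Icc measurableSet_Icc) C
    ((ae_restrict_iff' measurableSet_Icc).2 (Eventually.of_forall hC))

/-- The solutions of the linear equation depend linearly and boundedly, as elements of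
`L²(0,τ;X)`, on a parameter entering through the input operator. -/
theorem exists_clm_linear_solution {K : Type*} [NormedAddCommGroup K] [NormedSpace ℝ K]
    {T : C0Semigroup X} {Φ : ℝ → X →L[ℝ] X} {τ L : ℝ} (hτ : 0 ≤ τ)
    (hΦ : ∀ s ∈ Icc (0 : ℝ) τ, ‖Φ s‖ ≤ L)
    (hΦm : ∀ w : ℝ → X, ContinuousOn w (Icc 0 τ) → IntegrableOn (fun s => Φ s (w s)) (Icc 0 τ))
    (D : K →L[ℝ] U →L[ℝ] X) (u : L2 τ U) :
    ∃ S : K →L[ℝ] L2 τ X, ∀ r : K, ∃ y : ℝ → X,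
      IsMildSolution T τ 0 (fun s z => Φ s z) (fun s => D r (u s)) y ∧
      (∀ z, IsMildSolution T τ 0 (fun s z => Φ s z) (fun s => D r (u s)) z →
        EqOn z y (Icc 0 τ)) ∧
      (S r : ℝ → X) =ᵐ[volume.restrict (Icc 0 τ)] y := by
  obtain ⟨M, hM⟩ := T.exists_norm_clamp_le τ
  have hM0 : 0 ≤ M := (norm_nonneg _).trans (hM 0)
  have hL0 : 0 ≤ L := (norm_nonneg _).trans (hΦ 0 ⟨le_rfl, hτ⟩)
  choose y hy using fun r => exists_isMildSolution_linear T hτ hΦ hΦm (integrableOn_comp_L2 (D r) u)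
  have huniq : ∀ r z, IsMildSolution T τ 0 (fun s z => Φ s z) (fun s => D r (u s)) z →
      EqOn z (y r) (Icc 0 τ) := fun r z hz => (hy r).eqOn hΦ hΦm hz
  -- Uniqueness makes the chosen solutions linear in the parameter on `[0,τ]`, which is all that the
  -- `L²` class sees.
  have hcomb : ∀ (r₁ r₂ : K) (c : ℝ), ∀ s ∈ Icc (0 : ℝ) τ,
      y r₁ s + c • y r₂ s = y (r₁ + c • r₂) s := fun r₁ r₂ c =>
    huniq (r₁ + c • r₂) (fun s => y r₁ s + c • y r₂ s) <| by
      simpa using (hy r₁).add_smul c (hy r₂)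
  have hzero : ∀ s ∈ Icc (0 : ℝ) τ, y 0 s = 0 := fun s hs => by
    have := hcomb 0 0 1 s hs
    simpa using this
  have hmem : ∀ r, MemLp (y r) 2 (volume.restrict (Icc 0 τ)) := fun r =>
    memLp_of_continuousOn (hy r).1
  have hcoe : ∀ r, (((hmem r).toLp (y r) : L2 τ X) : ℝ → X) =ᵐ[volume.restrict (Icc 0 τ)] y r :=
    fun r => (hmem r).coeFn_toLp
  let S₀ : K →ₗ[ℝ] L2 τ X :=
    { toFun := fun r => (hmem r).toLp (y r)
      map_add' := fun r₁ r₂ => by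
        rw [← MemLp.toLp_add, MemLp.toLp_eq_toLp_iff]
        refine (ae_restrict_iff' measurableSet_Icc).2 (Eventually.of_forall fun s hs => ?_)
        simpa using (hcomb r₁ r₂ 1 s hs).symm
      map_smul' := fun c r => by
        rw [RingHom.id_apply, ← MemLp.toLp_const_smul, MemLp.toLp_eq_toLp_iff]
        refine (ae_restrict_iff' measurableSet_Icc).2 (Eventually.of_forall fun s hs => ?_)
        simpa [hzero s hs] using (hcomb 0 r c s hs).symm }
  -- This is `√τ`, the factor relating a uniform bound to an `L²` bound.
  let c : ℝ := measureUnivNNReal (volume.restrict (Icc 0 τ)) ^ (2 : ENNReal).toReal⁻¹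
  have hc : 0 ≤ c := by positivity
  have hI := integral_norm_nonneg u hτ
  refine ⟨S₀.mkContinuous
    (c * (M * (‖D‖ * ∫ s in (0 : ℝ)..τ, ‖u s‖) * Real.exp (M * L * τ))) fun r => ?_,
    fun r => ⟨y r, hy r, huniq r, hcoe r⟩⟩
  have hbound : ∀ᵐ s ∂(volume.restrict (Icc 0 τ)), ‖((hmem r).toLp (y r) : L2 τ X) s‖ ≤
      M * (‖D‖ * ‖r‖ * ∫ s in (0 : ℝ)..τ, ‖u s‖) * Real.exp (M * L * τ) := by
    filter_upwards [hcoe r, ae_restrict_mem measurableSet_Icc] with s hs hs'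
    rw [hs]
    refine ((hy r).norm_le hM hL0 hΦ hΦm (integrableOn_comp_L2 (D r) u) hs').trans ?_
    gcongr
    exact (integral_norm_apply_le (D r) u hτ).trans (by gcongr; exact D.le_opNorm r)
  refine (Lp.norm_le_of_ae_bound (by positivity) hbound).trans (le_of_eq ?_)
  simp only [c]
  ring

end Main

end SemilinearControl

/-! ### The main theorem. -/

theorem mainTheorem6
    {X U K : Type*}
    [NormedAddCommGroup X] [InnerProductSpace ℝ X] [CompleteSpace X]
    [TopologicalSpace.SeparableSpace X]
    [NormedAddCommGroup U] [InnerProductSpace ℝ U] [CompleteSpace U]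
    [NormedAddCommGroup K] [InnerProductSpace ℝ K] [CompleteSpace K]
    -- the linear part generates a strongly continuous semigroup
    (A : X →ₗ.[ℝ] X) (T : C0Semigroup X) (hA : Generates A T)
    -- the nonlinearity
    (F : X → X) (hF0 : F 0 = 0)
    (hFlip : ∀ δ : ℝ, 0 < δ → ∃ L : ℝ, 0 < L ∧ ∀ x₁ x₂ : X, ‖x₁‖ ≤ δ → ‖x₂‖ ≤ δ →
      ‖F x₂ - F x₁‖ ≤ L * ‖x₂ - x₁‖)
    (F' : X → X →L[ℝ] X) (hF' : ∀ x : X, HasGateauxDerivAt F (F' x) x)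
    (hF'bdd : ∀ s : Set X, Bornology.IsBounded s → Bornology.IsBounded (F' '' s))
    -- the actuator designs and the input operators
    (Kad : Set K) (B : K → U →L[ℝ] X)
    (hB : ∃ M : ℝ, 0 < M ∧ ∀ r ∈ Kad, ‖B r‖ ≤ M)
    (B' : K → K →L[ℝ] U →L[ℝ] X)
    (hB' : ∀ r ∈ Kad, HasGateauxDerivWithinAt B (B' r) Kad r)
    (hB'bdd : ∀ s : Set K, s ⊆ Kad → Bornology.IsBounded s → Bornology.IsBounded (B' '' s))
    -- initial condition, and a horizon on which the control-to-state map is defined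
    (x₀ : X) (R : ℝ) (hR : 0 < R) (τ : ℝ) (hτ : 0 < τ)
    (hex : ∀ u ∈ Uad τ R U, ∀ r ∈ Kad, ∃ x : ℝ → X, IsMildState T F τ x₀ (B r) u x)
    -- control input and interior actuator design
    (u : L2 τ U) (hu : u ∈ Uad τ R U) (r₀ : K) (hr₀ : r₀ ∈ interior Kad) :
    ∃ S' : K →L[ℝ] L2 τ X,
      HasGateauxDerivAt (fun r => controlToState T F B τ u r x₀) S' r₀ ∧
      ∀ r' : K, ∃ y : ℝ → X,
        IsMildSolution T τ 0
          (fun t z => F' (stateTrajectory T F τ x₀ (B r₀) u t) z)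
          (fun t => B' r₀ r' (u t)) y ∧
        (∀ z : ℝ → X,
          IsMildSolution T τ 0
            (fun t w => F' (stateTrajectory T F τ x₀ (B r₀) u t) w)
            (fun t => B' r₀ r' (u t)) z → Set.EqOn z y (Set.Icc 0 τ)) ∧
        (S' r' : ℝ → X) =ᵐ[volume.restrict (Set.Icc 0 τ)] y := by
  -- The trajectory has compact, hence bounded, range, and `F'` maps bounded sets to bounded sets.
  obtain ⟨L', hL'⟩ : ∃ L' : ℝ, ∀ s ∈ Set.Icc (0 : ℝ) τ,
      ‖F' (stateTrajectory T F τ x₀ (B r₀) u s)‖ ≤ L' := by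
    have hc := (isMildState_stateTrajectory T F τ x₀ (B r₀) u
      (hex u hu r₀ (interior_subset hr₀))).1
    obtain ⟨L', h⟩ := (hF'bdd _ (isCompact_Icc.image_of_continuousOn hc).isBounded).exists_norm_le
    exact ⟨L', fun s hs => h _ (Set.mem_image_of_mem _ (Set.mem_image_of_mem _ hs))⟩
  have hx := isMildState_stateTrajectory T F τ x₀ (B r₀) u (hex u hu r₀ (interior_subset hr₀))
  have hFc := continuous_of_lipschitz_on_balls hFlip
  obtain ⟨S', hS'⟩ := exists_clm_linear_solution (T := T) hτ.le hL'
    (fun w hw => integrableOn_gateauxDeriv_apply hFc hF' hx.1 hw hL') (B' r₀) u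
  refine ⟨S', fun r' => ?_, hS'⟩
  obtain ⟨y, hy, -, hSy⟩ := hS' r'
  obtain ⟨hslope, hdiff, hmem⟩ :=
    (hB' r₀ (interior_subset hr₀)).tendsto_of_mem_interior hr₀ r'
  obtain ⟨C, hC0, hC⟩ := exists_tendsto_norm_quotient_sub_le (b := fun ε => B (r₀ + ε • r'))
    (xε := fun ε => stateTrajectory T F τ x₀ (B (r₀ + ε • r')) u) hτ.le hFlip hF' hL' hx
    (hmem.mono fun ε hε => isMildState_stateTrajectory T F τ x₀ _ u (hex u hu _ hε))
    hdiff hslope hy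
  rw [HasLineDerivAt, hasDerivAt_iff_tendsto_slope_zero, tendsto_iff_norm_sub_tendsto_zero]
  have hlim := hC0.const_mul
    ((measureUnivNNReal (volume.restrict (Set.Icc 0 τ)) ^ (2 : ENNReal).toReal⁻¹ : NNReal) : ℝ)
  rw [mul_zero] at hlim
  -- The uniform bound `C ε` on the error of the quotient yields the `L²` bound `√τ * C ε`.
  refine squeeze_zero' (Eventually.of_forall fun _ => norm_nonneg _) ?_ hlim
  filter_upwards [hC] with ε hε
  have hCε : 0 ≤ C ε := (norm_nonneg _).trans (hε 0 ⟨le_rfl, hτ.le⟩)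
  rw [NNReal.coe_rpow]
  refine Lp.norm_le_of_ae_bound hCε ?_
  simp only [zero_add, zero_smul, add_zero]
  have hcoe : ∀ r, (controlToState T F B τ u r x₀ : ℝ → X) =ᵐ[volume.restrict (Set.Icc 0 τ)]
      stateTrajectory T F τ x₀ (B r) u := fun r =>
    (memLp_stateTrajectory T F τ x₀ (B r) u).coeFn_toLp
  filter_upwards [hcoe (r₀ + ε • r'), hcoe r₀, hSy, ae_restrict_mem measurableSet_Icc,
    Lp.coeFn_sub (ε⁻¹ • (controlToState T F B τ u (r₀ + ε • r') x₀
      - controlToState T F B τ u r₀ x₀)) (S' r'),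
    Lp.coeFn_smul ε⁻¹ (controlToState T F B τ u (r₀ + ε • r') x₀
      - controlToState T F B τ u r₀ x₀),
    Lp.coeFn_sub (controlToState T F B τ u (r₀ + ε • r') x₀)
      (controlToState T F B τ u r₀ x₀)] with t h1 h2 h3 ht h4 h5 h6
  rw [h4, Pi.sub_apply, h5, Pi.smul_apply, h6, Pi.sub_apply, h1, h2, h3]
  exact hε t ht
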